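/- Let $(M,g)$ be a smooth Riemannian manifold of dimension $n$ whose metric is a Hessian metric: near every point there are smooth local coordinates $x_1,\dots,x_n$ and a smooth function $\phi$ (automatically locally convex) with $$g_{ij}=\frac{\partial^2\phi}{\partial x_i\,\partial x_j}.$$ Let $\nabla$ be the Levi-Civita connection of $g$ and $R(u,v)w=\nabla_u\nabla_v w-\nabla_v\nabla_u w-\nabla_{[u,v]}w$ its curvature. At a point $x\in M$, with respect to a basis $b_1,\dots,b_n$ of $T_xM$, let $\Omega=(\Omega_{ij})$ be the matrix of $2$-forms on $T_xM$ determined by $R(u,v)b_i=\sum_j\Omega_{ij}(u,v)\,b_j$. A polynomial $P$ with complex coefficients in the entries of an $n\times n$ matrix is invariant if $P(TXT^{-1})=P(X)$ for all $X\in M_n(\mathbb C)$ and $T\in GL_n(\mathbb C)$; its Chern–Weil form at $x$ is the value $P(\Omega)$ in the commutative algebra of complex-valued alternating forms of even degree on $T_xM$. For $k\ge 1$, the $k$-th Pontryagin form is the $4k$-form $P_{2k}(\Omega)$, where $P_m(A)$ denotes the coefficient of $t^m$ in $\det(I+tA)$ (up to the constant factor $(2\pi)^{-2k}$ this is the form that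 represents the $k$-th Pontryagin class). **Theorem.** At every point of $M$, and with respect to every basis of the tangent space there: 1. the $k$-th Pontryagin form is zero for every $k\ge1$; 2. more generally, the Chern–Weil form $P(\Omega)$ is zero for every invariant polynomial $P$ without constant term. -/

import Mathlib

open Bundle
open scoped Manifold ContDiff

/-! ### Complex-valued differential forms at a point and the even part of their algebra -/

/-- The algebra `Λ^• V^* ⊗ ℂ` of complex-valued alternating forms on a (finite-dimensional) real
vector space `V`: the exterior algebra over `ℂ` of the complex-valued `1`-forms on `V`. -/
abbrev ComplexForms (V : Type*) [AddCommGroup V] [Module ℝ V] : Type _ :=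
  ExteriorAlgebra ℂ (V →ₗ[ℝ] ℂ)

/-- The wedge product of two complex-valued `1`-forms. -/
noncomputable def wedgeOneForms {V : Type*} [AddCommGroup V] [Module ℝ V] (α β : V →ₗ[ℝ] ℂ) :
    ComplexForms V :=
  ExteriorAlgebra.ι ℂ α * ExteriorAlgebra.ι ℂ β

/-- The algebra of forms of even degree: it is generated by the products of two `1`-forms. -/
noncomputable def evenForms (V : Type*) [AddCommGroup V] [Module ℝ V] : Subalgebra ℂ (ComplexForms V) :=
  Algebra.adjoin ℂ {η | ∃ α β : V →ₗ[ℝ] ℂ, η = wedgeOneForms α β}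

theorem wedgeOneForms_mem {V : Type*} [AddCommGroup V] [Module ℝ V] (α β : V →ₗ[ℝ] ℂ) :
    wedgeOneForms α β ∈ evenForms V :=
  Algebra.subset_adjoin ⟨α, β, rfl⟩

theorem wedgeOneForms_comm {V : Type*} [AddCommGroup V] [Module ℝ V] (α β γ δ : V →ₗ[ℝ] ℂ) :
    wedgeOneForms α β * wedgeOneForms γ δ = wedgeOneForms γ δ * wedgeOneForms α β := by
  have h : ∀ x y : V →ₗ[ℝ] ℂ, ExteriorAlgebra.ι ℂ x * ExteriorAlgebra.ι ℂ y
      = - (ExteriorAlgebra.ι ℂ y * ExteriorAlgebra.ι ℂ x) := fun x y ↦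
    eq_neg_of_add_eq_zero_left (ExteriorAlgebra.ι_add_mul_swap x y)
  unfold wedgeOneForms
  generalize hA : ExteriorAlgebra.ι ℂ α = A
  generalize hB : ExteriorAlgebra.ι ℂ β = B
  generalize hC : ExteriorAlgebra.ι ℂ γ = C
  generalize hD : ExteriorAlgebra.ι ℂ δ = D
  have hBC : B * C = -(C * B) := by rw [← hB, ← hC]; exact h β γ
  have hAC : A * C = -(C * A) := by rw [← hA, ← hC]; exact h α γ
  have hBD : B * D = -(D * B) := by rw [← hB, ← hD]; exact h β δ
  have hAD : A * D = -(D * A) := by rw [← hA, ← hD]; exact h α δ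
  calc A * B * (C * D) = A * (B * C) * D := by noncomm_ring
    _ = -((A * C) * (B * D)) := by rw [hBC]; noncomm_ring
    _ = -(C * (A * D) * B) := by rw [hAC, hBD]; noncomm_ring
    _ = C * D * (A * B) := by rw [hAD]; noncomm_ring

/-- Forms of even degree commute. -/
noncomputable instance evenForms.instCommRing (V : Type*) [AddCommGroup V] [Module ℝ V] :
    CommRing (evenForms V) :=
  { (evenForms V).toRing with
    mul_comm := (Algebra.isMulCommutative_adjoin ℂ (by
      rintro _ ⟨α, β, rfl⟩ _ ⟨γ, δ, rfl⟩
      exact wedgeOneForms_comm α β γ δ)).is_comm.comm }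

/-- The element `b^i` of the basis dual to `b`, as a complex-valued `1`-form. -/
noncomputable def dualOneForm {n : ℕ} {V : Type*} [AddCommGroup V] [Module ℝ V]
    (b : Module.Basis (Fin n) ℝ V) (i : Fin n) : V →ₗ[ℝ] ℂ :=
  Complex.ofRealCLM.toLinearMap ∘ₗ b.coord i

/-- The `2`-form `½ ∑_{k,l} η(b_k, b_l) b^k ∧ b^l`, i.e. the alternating bilinear form `η` as an
element of the algebra of forms of even degree. -/
noncomputable def twoForm {n : ℕ} {V : Type*} [AddCommGroup V] [Module ℝ V]
    (b : Module.Basis (Fin n) ℝ V) (η : V → V → ℝ) : evenForms V :=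
  (1 / 2 : ℂ) • ∑ k : Fin n, ∑ l : Fin n, (η (b k) (b l) : ℂ) •
    ⟨wedgeOneForms (dualOneForm b k) (dualOneForm b l), wedgeOneForms_mem _ _⟩

/-! ### Invariant polynomials -/

/-- A polynomial `P` in the entries of an `n × n` complex matrix is invariant if
`P (T X T⁻¹) = P X` for all matrices `X` and all invertible matrices `T`. -/
def IsInvariantPolynomial {n : ℕ} (P : MvPolynomial (Fin n × Fin n) ℂ) : Prop :=
  ∀ (T : GL (Fin n) ℂ) (X : Matrix (Fin n) (Fin n) ℂ),
    MvPolynomial.eval (fun ij : Fin n × Fin n ↦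
        ((T : Matrix (Fin n) (Fin n) ℂ) * X * ((T⁻¹ : GL (Fin n) ℂ) : Matrix (Fin n) (Fin n) ℂ))
          ij.1 ij.2) P
      = MvPolynomial.eval (fun ij : Fin n × Fin n ↦ X ij.1 ij.2) P

/-- The coefficient of `t ^ k` in `det (1 + t A)`, as a polynomial in the entries of the `n × n`
matrix `A`; this is the `k`-th elementary symmetric function of the eigenvalues. -/
noncomputable def chernPolynomial (n k : ℕ) : MvPolynomial (Fin n × Fin n) ℂ :=
  (Matrix.det (1 + (Polynomial.X : Polynomial (MvPolynomial (Fin n × Fin n) ℂ)) •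
    (Matrix.mvPolynomialX (Fin n) (Fin n) ℂ).map Polynomial.C)).coeff k

/-! ### Riemannian geometry -/

section Riemannian

variable {n : ℕ} {M : Type*} [TopologicalSpace M]
  [ChartedSpace (EuclideanSpace ℝ (Fin n)) M] [IsManifold (𝓡 n) ∞ M]

/-- The curvature `R(u, v) w = ∇_u ∇_v W - ∇_v ∇_u W - ∇_[U, V] W` at `x`, where `U, V, W` are
vector fields, smooth near `x`, that extend `u, v, w ∈ T_x M`.
Here `cov W y a` is the covariant derivative `∇_a W` at `y` in the direction `a ∈ T_y M`. -/
noncomputable def curvatureTensor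
    (cov : CovariantDerivative (𝓡 n) (EuclideanSpace ℝ (Fin n))
      (fun x : M ↦ TangentSpace (𝓡 n) x))
    (x : M) (u v w : TangentSpace (𝓡 n) x) : TangentSpace (𝓡 n) x :=
  let U : (y : M) → TangentSpace (𝓡 n) y := FiberBundle.extend (EuclideanSpace ℝ (Fin n)) u
  let V : (y : M) → TangentSpace (𝓡 n) y := FiberBundle.extend (EuclideanSpace ℝ (Fin n)) v
  let W : (y : M) → TangentSpace (𝓡 n) y := FiberBundle.extend (EuclideanSpace ℝ (Fin n)) w
  cov (fun y ↦ cov W y (V y)) x (U x) - cov (fun y ↦ cov W y (U y)) x (V x)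
    - cov W x (VectorField.mlieBracket (𝓡 n) U V x)

/-- The matrix `Ω` of `2`-forms at `x` representing the curvature with respect to the basis `b` of
`T_x M`: `R(u, v) b_i = ∑_j Ω_{ij}(u, v) b_j`. -/
noncomputable def curvatureMatrix
    (cov : CovariantDerivative (𝓡 n) (EuclideanSpace ℝ (Fin n))
      (fun x : M ↦ TangentSpace (𝓡 n) x))
    (x : M) (b : Module.Basis (Fin n) ℝ (TangentSpace (𝓡 n) x)) (i j : Fin n) :
    evenForms (TangentSpace (𝓡 n) x) :=
  twoForm b (fun u v ↦ b.coord j (curvatureTensor cov x u v (b i)))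

/-- The Chern--Weil form `P(R)` at `x`: the polynomial `P` evaluated on the curvature matrix, in the
commutative algebra of complex-valued forms of even degree. -/
noncomputable def chernWeilForm
    (cov : CovariantDerivative (𝓡 n) (EuclideanSpace ℝ (Fin n))
      (fun x : M ↦ TangentSpace (𝓡 n) x))
    (P : MvPolynomial (Fin n × Fin n) ℂ)
    (x : M) (b : Module.Basis (Fin n) ℝ (TangentSpace (𝓡 n) x)) :
    evenForms (TangentSpace (𝓡 n) x) :=
  MvPolynomial.aeval (fun ij : Fin n × Fin n ↦ curvatureMatrix cov x b ij.1 ij.2) P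

/-- The `k`-th Pontryagin form at `x`, a form of degree `4 k`: the Chern--Weil form of the
coefficient of `t ^ (2 k)` in `det (1 + t A)`. (Multiplying by `(2π)^(-2k)` gives the
representative of the `k`-th Pontryagin class.) -/
noncomputable def pontryaginForm
    (cov : CovariantDerivative (𝓡 n) (EuclideanSpace ℝ (Fin n))
      (fun x : M ↦ TangentSpace (𝓡 n) x))
    (k : ℕ) (x : M) (b : Module.Basis (Fin n) ℝ (TangentSpace (𝓡 n) x)) :
    evenForms (TangentSpace (𝓡 n) x) :=
  chernWeilForm cov (chernPolynomial n (2 * k)) x b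

variable [RiemannianBundle (fun x : M ↦ TangentSpace (𝓡 n) x)]
  [IsContMDiffRiemannianBundle (𝓡 n) ∞ (EuclideanSpace ℝ (Fin n))
    (fun x : M ↦ TangentSpace (𝓡 n) x)]

/-- `∇` is the Levi-Civita connection of the Riemannian metric: it is torsion-free and compatible
with the metric. -/
def IsLeviCivita
    (cov : CovariantDerivative (𝓡 n) (EuclideanSpace ℝ (Fin n))
      (fun x : M ↦ TangentSpace (𝓡 n) x)) : Prop :=
  haveI : IsContMDiffRiemannianBundle (𝓡 n) 1 (EuclideanSpace ℝ (Fin n))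
      (fun x : M ↦ TangentSpace (𝓡 n) x) :=
    IsContMDiffRiemannianBundle.of_le (n := ∞) (by norm_cast)
  cov.torsion = 0 ∧ cov.IsMetricCompatible

end Riemannian

/-- The Riemannian metric of `M` is a Hessian metric: near every point there are smooth local
coordinates `e` and a smooth potential `φ` with `g_{ij} = ∂²φ/∂x_i∂x_j`, that is,
`g(u, v) = D²φ(de u, de v)` for all `u, v ∈ T_y M`, for all `y` in the domain of `e`. The potential
is locally convex automatically, as `g` is positive definite. -/
def IsHessianMetric (n : ℕ) (M : Type*) [TopologicalSpace M]
    [ChartedSpace (EuclideanSpace ℝ (Fin n)) M]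
    [RiemannianBundle (fun x : M ↦ TangentSpace (𝓡 n) x)] : Prop :=
  ∀ x : M, ∃ e ∈ IsManifold.maximalAtlas (𝓡 n) ∞ M, x ∈ e.source ∧
    ∃ φ : EuclideanSpace ℝ (Fin n) → ℝ, ContDiffOn ℝ ∞ φ e.target ∧
      ∀ y ∈ e.source, ∀ u v : TangentSpace (𝓡 n) y,
        inner ℝ u v =
          iteratedFDeriv ℝ 2 φ (e y)
            ![mfderiv (𝓡 n) (𝓡 n) e y u, mfderiv (𝓡 n) (𝓡 n) e y v]

/-!
In Hessian coordinates the metric is `D²φ`, so all first derivatives of the metric are third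
derivatives of the potential `φ`, and the Koszul formula collapses: the Levi-Civita connection is
`D + ½ T`, where `D` is the flat connection of the coordinates and `T` (`hessianCubic`) is the
symmetric tensor with `g(T u v, w) = D³φ(u, v, w)` (`cov_eq_hessianCov`). In the curvature of
`D + ½ T` the fourth derivatives of `φ` cancel by symmetry, and what remains is quadratic in `T`:
`R(u, v) = -¼ [T u, T v]` (`hessianCov_curvature`, `curvature_eq_commutator`).

Hence, up to transposition, `Ω = -¼ a ∧ a` for a matrix `a` of `1`-forms
(`coe_twoForm_commutator`). As `a` has odd entries, `tr (a ^ (2m)) = tr (a · a ^ (2m-1))` changes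
sign when the two factors are interchanged, so `tr (Ω ^ m) = 0` for all `m ≥ 1`
(`Matrix.trace_pow_mul_self_ι`).

It remains to see that an invariant polynomial `P` is determined by the traces of powers. A generic
matrix is conjugate to the companion matrix of its characteristic polynomial, so `P` is a polynomial
in the coefficients of the characteristic polynomial
(`IsInvariantPolynomial.eq_aeval_companionMatrix`). By Newton's identities in the form
`Matrix.charpoly_eq_X_pow_of_trace_pow_eq_zero`, `Ω` has the same characteristic polynomial as the zero
matrix, and `P(Ω) = P(0) = 0`. The polynomials that define the Pontryagin forms are a special case.
-/

/-! ### Invariant polynomials and the characteristic polynomial -/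

namespace Matrix

/-- Jacobi's formula for the derivative of a determinant of polynomials. -/
theorem derivative_det {ι R : Type*} [Fintype ι] [DecidableEq ι] [CommRing R]
    (M : Matrix ι ι (Polynomial R)) :
    Polynomial.derivative M.det = (M.adjugate * M.map Polynomial.derivative).trace := by
  have h (i : ι) : (M.adjugate * M.map Polynomial.derivative) i i
      = (M.updateCol i (fun k ↦ Polynomial.derivative (M k i))).det := by
    rw [← cramer_apply, cramer_eq_adjugate_mulVec]
    rfl
  simp only [trace, diag_apply, h, det_apply, map_sum]
  rw [Finset.sum_comm]
  refine Finset.sum_congr rfl fun σ _ ↦ ?_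
  rw [← Finset.smul_sum]
  simp only [Units.smul_def, Polynomial.derivative_smul]
  congr 1
  rw [Finset.prod, Polynomial.derivative_prod]
  refine Finset.sum_congr rfl fun i _ ↦ ?_
  refine Eq.trans ?_ (Finset.mul_prod_erase _ _ (Finset.mem_univ i))
  rw [mul_comm]
  congr 1
  · simp
  · change ∏ j ∈ Finset.univ.erase i, M (σ j) j = _
    refine Finset.prod_congr rfl fun j hj ↦ ?_
    rw [updateCol_ne (Finset.ne_of_mem_erase hj)]

/-- Newton's identities in the case of vanishing power traces: in characteristic zero the powers of
a matrix all have trace zero only if its characteristic polynomial is that of the zero matrix. -/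
theorem charpolyRev_eq_one_of_trace_pow_eq_zero {ι R : Type*} [Fintype ι] [DecidableEq ι]
    [CommRing R] [Algebra ℚ R] (A : Matrix ι ι R) (hA : ∀ m : ℕ, 1 ≤ m → (A ^ m).trace = 0) :
    A.charpolyRev = 1 := by
  set N : Matrix ι ι (Polynomial R) := A.map Polynomial.C with hN
  set B := (1 - (Polynomial.X : Polynomial R) • N).adjugate with hB
  have htr (m : ℕ) (hm : 1 ≤ m) : (N ^ m).trace = 0 := by
    have : N ^ m = (A ^ m).map Polynomial.C := (Matrix.map_pow A Polynomial.C m).symm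
    rw [this]
    have := (AddMonoidHom.map_trace (Polynomial.C : R →+* Polynomial R).toAddMonoidHom (A ^ m))
    simp only [hA m hm, map_zero] at this
    exact this.symm
  have hBN : B = A.charpolyRev • 1 + (Polynomial.X : Polynomial R) • (N * B) := by
    have := mul_adjugate (1 - (Polynomial.X : Polynomial R) • N)
    rw [← hB, sub_mul, one_mul, smul_mul_assoc] at this
    rw [← sub_eq_iff_eq_add]
    exact this
  -- multiply `B = det + t N B` by `N ^ m` and take traces
  have hstep (m : ℕ) (hm : 1 ≤ m) :
      (B * N ^ m).trace = Polynomial.X * (B * N ^ (m + 1)).trace := by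
    conv_lhs => rw [hBN]
    rw [add_mul, trace_add, smul_mul_assoc, smul_mul_assoc, trace_smul, trace_smul, one_mul,
      htr m hm, smul_zero, zero_add, mul_assoc, trace_mul_comm, mul_assoc, ← pow_succ, smul_eq_mul]
  have hdvd (m : ℕ) : (B * N ^ 1).trace = Polynomial.X ^ m * (B * N ^ (m + 1)).trace := by
    induction m with
    | zero => simp
    | succ m ih => rw [ih, hstep (m + 1) (by lia), pow_succ Polynomial.X m, mul_assoc]
  -- a polynomial divisible by all powers of `t` is zero
  have hzero : (B * N).trace = 0 := by
    ext k
    have := hdvd (k + 1)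
    rw [pow_one] at this
    rw [this, Polynomial.coeff_X_pow_mul', if_neg (by lia), Polynomial.coeff_zero]
  have hder : Polynomial.derivative A.charpolyRev = 0 := by
    have hmap : (1 - (Polynomial.X : Polynomial R) • N).map Polynomial.derivative = -N := by
      ext i j : 2
      rw [map_apply, sub_apply, map_sub, hN, one_apply]
      split_ifs <;> simp
    rw [charpolyRev, derivative_det, ← hN, hmap, ← hB, mul_neg, trace_neg, hzero, neg_zero]
  ext k
  rcases k with _ | k
  · simp [Polynomial.coeff_zero_eq_eval_zero]
  · have h1 := congrArg (fun p ↦ Polynomial.coeff p k) hder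
    simp only [Polynomial.coeff_derivative, Polynomial.coeff_zero] at h1
    have h2 : algebraMap ℚ R ((k : ℚ) + 1)⁻¹ * ((k : R) + 1) = 1 := by
      have : (k : R) + 1 = algebraMap ℚ R ((k : ℚ) + 1) := by simp
      rw [this, ← map_mul, inv_mul_cancel₀ (by positivity), map_one]
    have h3 : A.charpolyRev.coeff (k + 1) = 0 := by
      calc _ = A.charpolyRev.coeff (k + 1)
              * (algebraMap ℚ R ((k : ℚ) + 1)⁻¹ * ((k : R) + 1)) := by rw [h2, mul_one]
        _ = algebraMap ℚ R ((k : ℚ) + 1)⁻¹ * (A.charpolyRev.coeff (k + 1) * ((k : R) + 1)) := by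
          ring
        _ = 0 := by rw [h1, mul_zero]
    rw [h3, Polynomial.coeff_one, if_neg (by lia)]

theorem charpoly_eq_X_pow_of_trace_pow_eq_zero {ι R : Type*} [Fintype ι] [DecidableEq ι]
    [CommRing R] [Algebra ℚ R] (A : Matrix ι ι R) (hA : ∀ m : ℕ, 1 ≤ m → (A ^ m).trace = 0) :
    A.charpoly = Polynomial.X ^ Fintype.card ι := by
  nontriviality R
  have hrev : A.charpoly.reverse = 1 := by
    rw [reverse_charpoly, charpolyRev_eq_one_of_trace_pow_eq_zero A hA]
  have hdeg := A.charpoly_natDegree_eq_dim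
  rw [← hdeg, A.charpoly_monic.eq_X_pow_iff_natDegree_le_natTrailingDegree]
  refine Polynomial.le_natTrailingDegree A.charpoly_monic.ne_zero fun i hi ↦ ?_
  have := congrArg (fun p ↦ Polynomial.coeff p (A.charpoly.natDegree - i)) hrev
  simp only [Polynomial.coeff_reverse, Polynomial.coeff_one] at this
  rwa [Polynomial.revAt_le (by lia), Nat.sub_sub_self hi.le, if_neg (by lia)] at this

/-- The companion matrix of `t ^ n + ∑ i, c i * t ^ i`. -/
def companionMatrix {n : ℕ} {R : Type*} [CommRing R] (c : Fin n → R) : Matrix (Fin n) (Fin n) R :=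
  of fun i j ↦ if (j : ℕ) + 1 < n then (if (i : ℕ) = j + 1 then 1 else 0) else - c i

/-- The matrix with columns `v, X v, X² v, …` for `v` the first vector of the standard basis. -/
def krylovMatrix {n : ℕ} {R : Type*} [CommRing R] (X : Matrix (Fin (n + 1)) (Fin (n + 1)) R) :
    Matrix (Fin (n + 1)) (Fin (n + 1)) R :=
  of fun i j ↦ (X ^ (j : ℕ)) i 0

/-- Multiplication by `X` acts on the Krylov basis through the companion matrix of the
characteristic polynomial. -/
theorem mul_krylovMatrix {n : ℕ} {R : Type*} [CommRing R]
    (X : Matrix (Fin (n + 1)) (Fin (n + 1)) R) :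
    X * krylovMatrix X = krylovMatrix X * companionMatrix fun i ↦ X.charpoly.coeff i := by
  nontriviality R
  ext i j
  have hL : (X * krylovMatrix X) i j = (X ^ ((j : ℕ) + 1)) i 0 := by
    rw [pow_succ', mul_apply, mul_apply]
    rfl
  rw [hL, mul_apply]
  by_cases hj : (j : ℕ) + 1 < n + 1
  · rw [Finset.sum_eq_single ⟨j + 1, hj⟩]
    · rw [krylovMatrix, companionMatrix, of_apply, of_apply, if_pos hj, if_pos rfl, mul_one]
    · intro k _ hk
      have : (k : ℕ) ≠ j + 1 := fun h ↦ hk (Fin.ext h)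
      rw [companionMatrix, of_apply, if_pos hj, if_neg this, mul_zero]
    · simp
  · have hj' : (j : ℕ) + 1 = n + 1 := by lia
    -- the last column is the Cayley-Hamilton theorem
    have hCH := congrFun (congrFun (aeval_self_charpoly X) i) 0
    rw [Polynomial.aeval_eq_sum_range, X.charpoly_natDegree_eq_dim, Fintype.card_fin,
      Finset.sum_range_succ] at hCH
    have hlead : X.charpoly.coeff (n + 1) = 1 := by
      have h := X.charpoly_monic.coeff_natDegree
      rwa [X.charpoly_natDegree_eq_dim, Fintype.card_fin] at h
    rw [hlead, one_smul, add_apply, zero_apply, sum_apply, Finset.sum_range] at hCH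
    rw [hj', eq_neg_of_add_eq_zero_right hCH, ← Finset.sum_neg_distrib]
    refine Finset.sum_congr rfl fun k _ ↦ ?_
    rw [krylovMatrix, companionMatrix, of_apply, of_apply, if_neg hj, smul_apply, smul_eq_mul]
    ring

/-- Cyclic matrices exist: for the shift of the standard basis the Krylov matrix is `1`. -/
theorem exists_det_krylovMatrix_ne_zero (n : ℕ) (R : Type*) [CommRing R] [Nontrivial R] :
    ∃ X : Matrix (Fin (n + 1)) (Fin (n + 1)) R, (krylovMatrix X).det ≠ 0 := by
  refine ⟨of fun i j ↦ if (i : ℕ) = j + 1 then 1 else 0, ?_⟩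
  set X : Matrix (Fin (n + 1)) (Fin (n + 1)) R := of fun i j ↦ if (i : ℕ) = j + 1 then 1 else 0
  have h (m : ℕ) (hm : m < n + 1) (i : Fin (n + 1)) :
      (X ^ m) i 0 = if (i : ℕ) = m then 1 else 0 := by
    induction m generalizing i with
    | zero => rw [pow_zero, one_apply]; simp only [Fin.ext_iff, Fin.val_zero]
    | succ m ih =>
      rw [pow_succ', mul_apply, Finset.sum_eq_single ⟨m, by lia⟩]
      · rw [ih (by lia), if_pos rfl, mul_one]; rfl
      · intro k _ hk
        have : (k : ℕ) ≠ m := fun h ↦ hk (Fin.ext h)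
        rw [ih (by lia), if_neg this, mul_zero]
      · simp
  have : krylovMatrix X = 1 := by
    ext i j
    rw [krylovMatrix, of_apply, h j j.2, one_apply]
    simp [Fin.ext_iff]
  simp [this]

theorem companionMatrix_map {n : ℕ} {R S : Type*} [CommRing R] [CommRing S] (f : R →+* S)
    (c : Fin n → R) : (companionMatrix c).map f = companionMatrix fun i ↦ f (c i) := by
  ext i j
  simp only [companionMatrix, map_apply, of_apply]
  split_ifs <;> simp

theorem krylovMatrix_map {n : ℕ} {R S : Type*} [CommRing R] [CommRing S] (f : R →+* S)
    (X : Matrix (Fin (n + 1)) (Fin (n + 1)) R) :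
    (krylovMatrix X).map f = krylovMatrix (X.map f) := by
  ext i j
  have : (X.map f) ^ (j : ℕ) = (X ^ (j : ℕ)).map f := (Matrix.map_pow X f j).symm
  simp only [krylovMatrix, map_apply, of_apply, this]

end Matrix

open Matrix in
theorem MvPolynomial.aeval_aeval_companionMatrix {n : ℕ} (P : MvPolynomial (Fin n × Fin n) ℂ)
    {R : Type*} [CommRing R] [Algebra ℂ R] (A : Matrix (Fin n) (Fin n) R) :
    aeval (fun ij : Fin n × Fin n ↦ A ij.1 ij.2)
        (aeval (fun ij : Fin n × Fin n ↦ companionMatrix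
          (fun i : Fin n ↦ (mvPolynomialX (Fin n) (Fin n) ℂ).charpoly.coeff i) ij.1 ij.2) P)
      = aeval (fun ij : Fin n × Fin n ↦ companionMatrix
          (fun i : Fin n ↦ A.charpoly.coeff i) ij.1 ij.2) P := by
  rw [comp_aeval_apply]
  congr 2
  funext ij
  set f : MvPolynomial (Fin n × Fin n) ℂ →ₐ[ℂ] R := aeval fun ij : Fin n × Fin n ↦ A ij.1 ij.2
  have hA : (mvPolynomialX (Fin n) (Fin n) ℂ).map (f : _ →+* R) = A := by
    ext i j
    simp [f]
  have h := congrFun (congrFun (companionMatrix_map (f : _ →+* R)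
    (fun i : Fin n ↦ (mvPolynomialX (Fin n) (Fin n) ℂ).charpoly.coeff i)) ij.1) ij.2
  simp only [← Polynomial.coeff_map, ← charpoly_map, hA] at h
  exact h

open Matrix in
/-- An invariant polynomial takes the same value at a matrix as at the companion matrix of its
characteristic polynomial. A matrix that has the first standard basis vector as a cyclic vector is
conjugate to this companion matrix, and these matrices are Zariski dense. -/
theorem IsInvariantPolynomial.eq_aeval_companionMatrix {n : ℕ}
    {P : MvPolynomial (Fin (n + 1) × Fin (n + 1)) ℂ} (hP : IsInvariantPolynomial P) :
    P = MvPolynomial.aeval (fun ij : Fin (n + 1) × Fin (n + 1) ↦ companionMatrix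
      (fun i : Fin (n + 1) ↦ (mvPolynomialX (Fin (n + 1)) (Fin (n + 1)) ℂ).charpoly.coeff i)
        ij.1 ij.2) P := by
  set G := mvPolynomialX (Fin (n + 1)) (Fin (n + 1)) ℂ with hG
  have hev (X : Matrix (Fin (n + 1)) (Fin (n + 1)) ℂ) :
      G.map (MvPolynomial.eval fun ij : Fin (n + 1) × Fin (n + 1) ↦ X ij.1 ij.2) = X := by
    ext i j
    simp [hG]
  have hdet (X : Matrix (Fin (n + 1)) (Fin (n + 1)) ℂ) :
      MvPolynomial.eval (fun ij : Fin (n + 1) × Fin (n + 1) ↦ X ij.1 ij.2) (krylovMatrix G).det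
        = (krylovMatrix X).det := by
    rw [RingHom.map_det, RingHom.mapMatrix_apply, krylovMatrix_map, hev]
  have hne : (krylovMatrix G).det ≠ 0 := by
    obtain ⟨X, hX⟩ := exists_det_krylovMatrix_ne_zero n ℂ
    intro h
    rw [← hdet, h, map_zero] at hX
    exact hX rfl
  -- it suffices to compare values at complex matrices `X`, where both sides are multiplied by a
  -- determinant that vanishes unless `X` is conjugate to the companion matrix
  refine mul_right_cancel₀ hne (MvPolynomial.funext fun x ↦ ?_)
  obtain ⟨X, rfl⟩ : ∃ X : Matrix (Fin (n + 1)) (Fin (n + 1)) ℂ, x = fun ij ↦ X ij.1 ij.2 :=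
    ⟨of fun i j ↦ x (i, j), rfl⟩
  rw [map_mul, map_mul, hdet]
  by_cases hX : (krylovMatrix X).det = 0
  · rw [hX, mul_zero, mul_zero]
  congr 1
  have hcomp := MvPolynomial.aeval_aeval_companionMatrix P X
  simp only [MvPolynomial.aeval_eq_eval] at hcomp
  rw [hcomp]
  let T : GL (Fin (n + 1)) ℂ := GeneralLinearGroup.mkOfDetNeZero (krylovMatrix X) hX
  have hT : (T : Matrix _ _ ℂ) = krylovMatrix X := rfl
  rw [← hP T (companionMatrix fun i : Fin (n + 1) ↦ X.charpoly.coeff i)]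
  congr 2
  have : X = (T : Matrix _ _ ℂ) * (companionMatrix fun i : Fin (n + 1) ↦ X.charpoly.coeff i)
      * ((T⁻¹ : GL (Fin (n + 1)) ℂ) : Matrix _ _ ℂ) := by
    rw [hT, ← mul_krylovMatrix, ← hT, mul_assoc, ← Units.val_mul, mul_inv_cancel, Units.val_one,
      mul_one]
  rw [← this]

open Matrix in
/-- The value of an invariant polynomial at a matrix over a commutative algebra is determined by the
characteristic polynomial of the matrix. -/
theorem IsInvariantPolynomial.aeval_eq_of_charpoly_eq {n : ℕ}
    {P : MvPolynomial (Fin n × Fin n) ℂ} (hP : IsInvariantPolynomial P)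
    {R : Type*} [CommRing R] [Algebra ℂ R] {A B : Matrix (Fin n) (Fin n) R}
    (h : A.charpoly = B.charpoly) :
    MvPolynomial.aeval (fun ij : Fin n × Fin n ↦ A ij.1 ij.2) P
      = MvPolynomial.aeval (fun ij : Fin n × Fin n ↦ B ij.1 ij.2) P := by
  rcases n with _ | n
  · congr 2
    exact Subsingleton.elim _ _
  rw [hP.eq_aeval_companionMatrix, MvPolynomial.aeval_aeval_companionMatrix,
    MvPolynomial.aeval_aeval_companionMatrix, h]

open Matrix in
theorem IsInvariantPolynomial.aeval_eq_zero_of_trace_pow_eq_zero {n : ℕ}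
    {P : MvPolynomial (Fin n × Fin n) ℂ} (hP : IsInvariantPolynomial P)
    (hP₀ : MvPolynomial.constantCoeff P = 0)
    {R : Type*} [CommRing R] [Algebra ℂ R] {A : Matrix (Fin n) (Fin n) R}
    (hA : ∀ m : ℕ, 1 ≤ m → (A ^ m).trace = 0) :
    MvPolynomial.aeval (fun ij : Fin n × Fin n ↦ A ij.1 ij.2) P = 0 := by
  let _ : Algebra ℚ R := Algebra.compHom R (algebraMap ℚ ℂ)
  have h : A.charpoly = (0 : Matrix (Fin n) (Fin n) R).charpoly := by
    rw [charpoly_eq_X_pow_of_trace_pow_eq_zero A hA, charpoly_zero]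
  rw [hP.aeval_eq_of_charpoly_eq h]
  simp only [Matrix.zero_apply]
  rw [MvPolynomial.aeval_zero', hP₀, map_zero]

/-! ### The Chern polynomials -/

open Matrix in
theorem eval_chernPolynomial (n k : ℕ) (X : Matrix (Fin n) (Fin n) ℂ) :
    MvPolynomial.eval (fun ij : Fin n × Fin n ↦ X ij.1 ij.2) (chernPolynomial n k)
      = (det (1 + (Polynomial.X : Polynomial ℂ) • X.map Polynomial.C)).coeff k := by
  rw [chernPolynomial, ← Polynomial.coeff_map, ← Polynomial.coe_mapRingHom, RingHom.map_det]
  congr 2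
  ext i j : 2
  simp only [RingHom.mapMatrix_apply, map_apply, Matrix.add_apply, Matrix.smul_apply, smul_eq_mul,
    one_apply]
  split_ifs <;> simp

open Matrix in
theorem isInvariantPolynomial_chernPolynomial (n k : ℕ) :
    IsInvariantPolynomial (chernPolynomial n k) := by
  intro T X
  rw [eval_chernPolynomial, eval_chernPolynomial]
  congr 1
  set U := Units.map (Polynomial.C (R := ℂ)).mapMatrix.toMonoidHom T with hU
  have h : (1 + (Polynomial.X : Polynomial ℂ) • ((T : Matrix (Fin n) (Fin n) ℂ) * X *
      ((T⁻¹ : GL (Fin n) ℂ) : Matrix (Fin n) (Fin n) ℂ)).map Polynomial.C)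
      = (U : Matrix (Fin n) (Fin n) (Polynomial ℂ))
        * (1 + (Polynomial.X : Polynomial ℂ) • X.map Polynomial.C) * (U⁻¹).val := by
    rw [mul_add, add_mul, mul_one, Units.mul_inv, mul_smul_comm, smul_mul_assoc]
    congr 2
    rw [Matrix.map_mul, Matrix.map_mul]
    rfl
  rw [h, det_units_conj]

open Matrix in
theorem constantCoeff_chernPolynomial (n : ℕ) {k : ℕ} (hk : 1 ≤ k) :
    MvPolynomial.constantCoeff (chernPolynomial n k) = 0 := by
  rw [← MvPolynomial.eval_zero]
  have h := eval_chernPolynomial n k 0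
  simp only [Matrix.zero_apply] at h
  refine h.trans ?_
  rw [Matrix.map_zero _ (map_zero _), smul_zero, add_zero, det_one, Polynomial.coeff_one,
    if_neg (by lia)]

/-! ### Commutators and the curvature matrix -/

section OneForms

open ExteriorAlgebra

variable {K N ι : Type*} [Field K] [AddCommGroup N] [Module K N] [Fintype ι] [DecidableEq ι]

/-- For a matrix `a` of `1`-forms, the entries of the even powers of `a` are even forms, so they
commute with `1`-forms. -/
theorem Matrix.pow_mul_self_ι_comm (a : Matrix ι ι N) (m : ℕ) (i j : ι) (v : N) :
    ExteriorAlgebra.ι K v * ((a.map (ExteriorAlgebra.ι K) * a.map (ExteriorAlgebra.ι K)) ^ m) i j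
      = ((a.map (ExteriorAlgebra.ι K) * a.map (ExteriorAlgebra.ι K)) ^ m) i j
        * ExteriorAlgebra.ι K v := by
  have swap (x y : N) : ExteriorAlgebra.ι K x * ExteriorAlgebra.ι K y
      = - (ExteriorAlgebra.ι K y * ExteriorAlgebra.ι K x) :=
    eq_neg_of_add_eq_zero_left (ι_add_mul_swap x y)
  induction m generalizing i j with
  | zero =>
    rw [pow_zero, one_apply]
    split_ifs <;> simp
  | succ m ih =>
    have h2 (k : ι) : Commute (ExteriorAlgebra.ι K v)
        ((a.map (ExteriorAlgebra.ι K) * a.map (ExteriorAlgebra.ι K)) k j) := by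
      rw [mul_apply]
      refine Commute.sum_right _ _ _ fun l _ ↦ ?_
      rw [commute_iff_eq, map_apply, map_apply, ← mul_assoc, swap v, neg_mul, mul_assoc, swap v,
        mul_neg, neg_neg, mul_assoc]
    rw [pow_succ, mul_apply]
    exact Commute.sum_right _ _ _ fun k _ ↦ Commute.mul_right (ih i k) (h2 k)

/-- The powers of the square of a matrix `a` of `1`-forms have trace zero: the trace of
`a ^ (2 m) = a * a ^ (2 m - 1)` changes sign when the two odd factors are interchanged. -/
theorem Matrix.trace_pow_mul_self_ι [CharZero K] (a : Matrix ι ι N) {m : ℕ} (hm : 1 ≤ m) :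
    ((a.map (ExteriorAlgebra.ι K) * a.map (ExteriorAlgebra.ι K)) ^ m).trace = 0 := by
  obtain ⟨m, rfl⟩ := Nat.exists_eq_add_of_le' hm
  set A := a.map (ExteriorAlgebra.ι K) with hA
  set S := (A * A) ^ m with hS
  have swap (x y : N) : ExteriorAlgebra.ι K x * ExteriorAlgebra.ι K y
      = - (ExteriorAlgebra.ι K y * ExteriorAlgebra.ι K x) :=
    eq_neg_of_add_eq_zero_left (ι_add_mul_swap x y)
  have hodd (i j k l : ι) : A i j * (A * S) k l = - ((A * S) k l * A i j) := by
    rw [mul_apply, Finset.mul_sum, Finset.sum_mul, ← Finset.sum_neg_distrib]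
    refine Finset.sum_congr rfl fun p _ ↦ ?_
    have h1 : A i j * S p l = S p l * A i j := Matrix.pow_mul_self_ι_comm a m p l (a i j)
    have h2 : A i j * A k p = -(A k p * A i j) := swap _ _
    rw [← mul_assoc, h2, neg_mul, mul_assoc, h1, mul_assoc]
  have hcomm : A * S = S * A := by
    have : Commute A (A * A) := Commute.mul_right rfl rfl
    exact this.pow_right m
  have h : ((A * A) ^ (m + 1)).trace = - ((A * A) ^ (m + 1)).trace := by
    have e1 : (A * A) ^ (m + 1) = A * (A * S) := by rw [pow_succ', mul_assoc]
    have e2 : (A * A) ^ (m + 1) = (A * S) * A := by rw [pow_succ, ← hS, hcomm, mul_assoc]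
    calc _ = (A * (A * S)).trace := by rw [e1]
      _ = - ((A * S) * A).trace := by
        simp only [trace, diag_apply]
        simp_rw [mul_apply (M := A) (N := A * S), mul_apply (M := A * S) (N := A)]
        rw [Finset.sum_comm, ← Finset.sum_neg_distrib]
        refine Finset.sum_congr rfl fun i _ ↦ ?_
        rw [← Finset.sum_neg_distrib]
        exact Finset.sum_congr rfl fun j _ ↦ hodd _ _ _ _
      _ = _ := by rw [e2]
  have h2 : (2 : K) • ((A * A) ^ (m + 1)).trace = 0 := by
    rw [two_smul]
    exact eq_neg_iff_add_eq_zero.1 h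
  exact (smul_eq_zero.1 h2).resolve_left two_ne_zero

end OneForms

/-- If the curvature is `R(u, v) = c [S u, S v]` for a linear family `S` of endomorphisms, then the
transpose of its matrix of `2`-forms is `c • a ∧ a` with `a` the matrix of `1`-forms of `S`. -/
theorem coe_twoForm_commutator {n : ℕ} {V : Type*} [AddCommGroup V] [Module ℝ V]
    (b : Module.Basis (Fin n) ℝ V) (S : V →ₗ[ℝ] Module.End ℝ V) (c : ℝ) (i j : Fin n) :
    (twoForm b (fun u v ↦ b.coord j (c • (S u (S v (b i)) - S v (S u (b i))))) : ComplexForms V)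
      = (c : ℂ) • ∑ m, ExteriorAlgebra.ι ℂ (∑ k, (b.coord j (S (b k) (b m)) : ℂ) • dualOneForm b k)
        * ExteriorAlgebra.ι ℂ (∑ k, (b.coord m (S (b k) (b i)) : ℂ) • dualOneForm b k) := by
  set w : Fin n → ComplexForms V := fun k ↦ ExteriorAlgebra.ι ℂ (dualOneForm b k) with hw
  have swap (k l : Fin n) : w k * w l = - (w l * w k) :=
    eq_neg_of_add_eq_zero_left (ExteriorAlgebra.ι_add_mul_swap _ _)
  set s : Fin n → Fin n → ℂ := fun k l ↦ (b.coord j (S (b k) (S (b l) (b i))) : ℂ) with hs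
  have hsum (k l : Fin n) : s k l
      = ∑ m, (b.coord j (S (b k) (b m)) : ℂ) * (b.coord m (S (b l) (b i)) : ℂ) := by
    have : b.coord j (S (b k) (S (b l) (b i)))
        = ∑ m, b.coord j (S (b k) (b m)) * b.coord m (S (b l) (b i)) := by
      conv_lhs => rw [← b.sum_repr (S (b l) (b i))]
      simp only [map_sum, map_smul, smul_eq_mul, Module.Basis.coord_apply, mul_comm]
    rw [hs]
    simp only [this]
    push_cast
    rfl
  have hL : (twoForm b (fun u v ↦ b.coord j (c • (S u (S v (b i)) - S v (S u (b i)))))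
        : ComplexForms V)
      = (c : ℂ) • ∑ k, ∑ l, s k l • (w k * w l) := by
    have h1 : (twoForm b (fun u v ↦ b.coord j (c • (S u (S v (b i)) - S v (S u (b i)))))
        : ComplexForms V)
        = (1 / 2 : ℂ) • ∑ k, ∑ l, ((c : ℂ) * (s k l - s l k)) • (w k * w l) := by
      simp only [twoForm, Subalgebra.coe_smul, AddSubmonoidClass.coe_finsetSum, wedgeOneForms,
        map_smul, map_sub, smul_eq_mul, hs, hw, Complex.ofReal_mul, Complex.ofReal_sub]
    have h2 : ∑ k, ∑ l, s l k • (w k * w l) = - ∑ k, ∑ l, s k l • (w k * w l) := by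
      rw [Finset.sum_comm, ← Finset.sum_neg_distrib]
      refine Finset.sum_congr rfl fun k _ ↦ ?_
      rw [← Finset.sum_neg_distrib]
      refine Finset.sum_congr rfl fun l _ ↦ ?_
      rw [swap l k, smul_neg]
    rw [h1]
    simp_rw [mul_smul, sub_smul, smul_sub, Finset.sum_sub_distrib]
    simp_rw [← Finset.smul_sum, h2]
    module
  rw [hL]
  congr 1
  simp only [map_sum, map_smul, Finset.sum_mul_sum, smul_mul_smul_comm]
  simp_rw [hsum, Finset.sum_smul]
  rw [Finset.sum_comm_cycle]

open Matrix in
/-- If the curvature is a multiple of a commutator `[S u, S v]`, all Chern–Weil forms of invariant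
polynomials without constant term vanish. -/
theorem chernWeilForm_eq_zero_of_curvatureTensor_eq {n : ℕ} {M : Type*} [TopologicalSpace M]
    [ChartedSpace (EuclideanSpace ℝ (Fin n)) M] [IsManifold (𝓡 n) ∞ M]
    (cov : CovariantDerivative (𝓡 n) (EuclideanSpace ℝ (Fin n))
      (fun x : M ↦ TangentSpace (𝓡 n) x))
    (x : M) (S : TangentSpace (𝓡 n) x →ₗ[ℝ] Module.End ℝ (TangentSpace (𝓡 n) x)) (c : ℝ)
    (hS : ∀ u v w, curvatureTensor cov x u v w = c • (S u (S v w) - S v (S u w)))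
    (b : Module.Basis (Fin n) ℝ (TangentSpace (𝓡 n) x))
    {P : MvPolynomial (Fin n × Fin n) ℂ} (hP : IsInvariantPolynomial P)
    (hP₀ : MvPolynomial.constantCoeff P = 0) : chernWeilForm cov P x b = 0 := by
  set Ω : Matrix (Fin n) (Fin n) (evenForms (TangentSpace (𝓡 n) x)) :=
    of fun i j ↦ curvatureMatrix cov x b i j with hΩ
  set a : Matrix (Fin n) (Fin n) (TangentSpace (𝓡 n) x →ₗ[ℝ] ℂ) :=
    of fun i j ↦ ∑ k, (b.coord i (S (b k) (b j)) : ℂ) • dualOneForm b k with ha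
  let val : evenForms (TangentSpace (𝓡 n) x) →+* ComplexForms (TangentSpace (𝓡 n) x) :=
    ((evenForms (TangentSpace (𝓡 n) x)).val : _ →+* _)
  have hval : Ωᵀ.map val
      = (c : ℂ) • (a.map (ExteriorAlgebra.ι ℂ) * a.map (ExteriorAlgebra.ι ℂ)) := by
    ext j i
    rw [Matrix.smul_apply, mul_apply]
    have := coe_twoForm_commutator b S c i j
    simp only [← hS] at this
    exact this
  refine hP.aeval_eq_zero_of_trace_pow_eq_zero hP₀ (A := Ω) fun m hm ↦ ?_
  have h : val (Ω ^ m).trace = 0 := by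
    rw [← trace_transpose, transpose_pow]
    have h1 : val ((Ωᵀ) ^ m).trace = (((Ωᵀ) ^ m).map val).trace :=
      AddMonoidHom.map_trace val.toAddMonoidHom _
    have h2 : ((Ωᵀ) ^ m).map val = (Ωᵀ.map val) ^ m := Matrix.map_pow _ val m
    rw [h1, h2, hval, smul_pow, trace_smul, trace_pow_mul_self_ι a hm, smul_zero]
  exact Subtype.ext h

/-! ### Curvature in Hessian coordinates -/

section Flat

set_option maxSynthPendingDepth 3

open Topology

variable {E : Type*} [NormedAddCommGroup E] [NormedSpace ℝ E] {φ : E → ℝ} {z : E}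

theorem HasFDerivAt.clm_apply_const {F G : Type*} [NormedAddCommGroup F] [NormedSpace ℝ F]
    [NormedAddCommGroup G] [NormedSpace ℝ G] {f : E → F →L[ℝ] G} {f' : E →L[ℝ] F →L[ℝ] G}
    (hf : HasFDerivAt f f' z) (v : F) : HasFDerivAt (fun y ↦ f y v) (f'.flip v) z := by
  simpa using hf.clm_apply (hasFDerivAt_const v z)

/-- The tensor `T` with `D²φ (T a b, c) = D³φ (a, b, c)`. Half of it is the difference of the
Levi-Civita connection of the metric `D²φ` and the flat connection. It takes the junk value `0`
where `D²φ` is degenerate. -/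
noncomputable def hessianCubic (φ : E → ℝ) (z : E) : E →L[ℝ] E →L[ℝ] E :=
  (ContinuousLinearMap.compL ℝ E (E →L[ℝ] ℝ) E (fderiv ℝ (fderiv ℝ φ) z).inverse) ∘L
    fderiv ℝ (fderiv ℝ (fderiv ℝ φ)) z

theorem fderiv_fderiv_hessianCubic (hz : (fderiv ℝ (fderiv ℝ φ) z).IsInvertible) (a b c : E) :
    fderiv ℝ (fderiv ℝ φ) z (hessianCubic φ z a b) c
      = fderiv ℝ (fderiv ℝ (fderiv ℝ φ)) z a b c := by
  have h : fderiv ℝ (fderiv ℝ φ) z (hessianCubic φ z a b)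
      = fderiv ℝ (fderiv ℝ (fderiv ℝ φ)) z a b := by
    change fderiv ℝ (fderiv ℝ φ) z ((fderiv ℝ (fderiv ℝ φ) z).inverse _) = _
    obtain ⟨L, hL⟩ := hz
    rw [← hL, ContinuousLinearMap.inverse_equiv]
    exact L.apply_symm_apply _
  rw [h]

theorem ContDiffAt.fderiv_infty {F : Type*} [NormedAddCommGroup F] [NormedSpace ℝ F] {f : E → F}
    (hf : ContDiffAt ℝ ∞ f z) : ContDiffAt ℝ ∞ (fderiv ℝ f) z :=
  hf.fderiv_right (by norm_cast)

theorem ContDiffAt.hessianCubic [CompleteSpace E] (hφ : ContDiffAt ℝ ∞ φ z)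
    (hz : (fderiv ℝ (fderiv ℝ φ) z).IsInvertible) : ContDiffAt ℝ ∞ (hessianCubic φ) z := by
  have hinv : ContDiffAt ℝ ∞ (fun y ↦ (fderiv ℝ (fderiv ℝ φ) y).inverse) z := by
    obtain ⟨L, hL⟩ := hz
    have : ContDiffAt ℝ ∞ ContinuousLinearMap.inverse (fderiv ℝ (fderiv ℝ φ) z) := by
      rw [← hL]
      exact contDiffAt_map_inverse L
    exact this.comp z hφ.fderiv_infty.fderiv_infty
  have hcomp : ContDiffAt ℝ ∞ (fun y ↦ ContinuousLinearMap.compL ℝ E (E →L[ℝ] ℝ) E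
      (fderiv ℝ (fderiv ℝ φ) y).inverse) z :=
    contDiffAt_const.clm_apply hinv
  exact ContDiffAt.clm_comp hcomp hφ.fderiv_infty.fderiv_infty.fderiv_infty

theorem fderiv_fderiv_comm (hφ : ContDiffAt ℝ 2 φ z) (a b : E) :
    fderiv ℝ (fderiv ℝ φ) z a b = fderiv ℝ (fderiv ℝ φ) z b a :=
  (hφ.isSymmSndFDerivAt (by simp)).eq a b

theorem fderiv₃_comm_left (hφ : ContDiffAt ℝ ∞ φ z) (a b c : E) :
    fderiv ℝ (fderiv ℝ (fderiv ℝ φ)) z a b c = fderiv ℝ (fderiv ℝ (fderiv ℝ φ)) z b a c := by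
  rw [(hφ.fderiv_infty.isSymmSndFDerivAt (by simp; norm_cast)).eq a b]

theorem fderiv₃_comm_right (hφ : ContDiffAt ℝ ∞ φ z) (a b c : E) :
    fderiv ℝ (fderiv ℝ (fderiv ℝ φ)) z a b c = fderiv ℝ (fderiv ℝ (fderiv ℝ φ)) z a c b := by
  have hB : DifferentiableAt ℝ (fderiv ℝ (fderiv ℝ φ)) z :=
    hφ.fderiv_infty.fderiv_infty.differentiableAt (by simp)
  have hd (b c : E) : fderiv ℝ (fun y ↦ fderiv ℝ (fderiv ℝ φ) y b c) z a
      = fderiv ℝ (fderiv ℝ (fderiv ℝ φ)) z a b c := by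
    rw [((hB.hasFDerivAt.clm_apply_const b).clm_apply_const c).fderiv]
    rfl
  rw [← hd b c, ← hd c b]
  have he : (fun y ↦ fderiv ℝ (fderiv ℝ φ) y b c) =ᶠ[𝓝 z] fun y ↦ fderiv ℝ (fderiv ℝ φ) y c b := by
    filter_upwards [(hφ.of_le (m := 2) (by norm_cast)).eventually (by simp)] with y hy
    using fderiv_fderiv_comm hy b c
  rw [he.fderiv_eq]

/-- The covariant derivative at `z`, in the direction `a`, of the vector field `w` with respect to
the Levi-Civita connection of the metric `D²φ`. -/
noncomputable def hessianCov (φ : E → ℝ) (w : E → E) (z a : E) : E :=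
  fderiv ℝ w z a + (1 / 2 : ℝ) • hessianCubic φ z a (w z)

/-- The fourth derivatives of the potential do not contribute to the curvature: the part of `DT`
that is not symmetric in its first two arguments is quadratic in `T`. -/
theorem fderiv_hessianCubic_sub [FiniteDimensional ℝ E] (hφ : ContDiffAt ℝ ∞ φ z)
    (hz : (fderiv ℝ (fderiv ℝ φ) z).IsInvertible) (u v w : E) :
    fderiv ℝ (hessianCubic φ) z u v w - fderiv ℝ (hessianCubic φ) z v u w
      = hessianCubic φ z v (hessianCubic φ z u w) - hessianCubic φ z u (hessianCubic φ z v w) := by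
  have := FiniteDimensional.complete ℝ E
  set B := fderiv ℝ (fderiv ℝ φ) with hB
  set T := hessianCubic φ with hT
  have hBd : DifferentiableAt ℝ B z := hφ.fderiv_infty.fderiv_infty.differentiableAt (by simp)
  have hDd : DifferentiableAt ℝ (fderiv ℝ B) z :=
    hφ.fderiv_infty.fderiv_infty.fderiv_infty.differentiableAt (by simp)
  have hTd : DifferentiableAt ℝ T z := (hφ.hessianCubic hz).differentiableAt (by simp)
  have hinv : ∀ᶠ y in 𝓝 z, (B y).IsInvertible := by
    obtain ⟨L, hL⟩ := hz
    have h1 : ∀ᶠ A in 𝓝 (B z), A.IsInvertible := hL ▸ ContinuousLinearEquiv.nhds L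
    exact hBd.continuousAt.eventually h1
  -- the derivative of `D²φ (T v w, c) = D³φ (v, w, c)` in the direction `u`
  have key (u v w c : E) : B z (fderiv ℝ T z u v w) c
      = fderiv ℝ (fderiv ℝ B) z u v w c - B z (T z u (T z v w)) c := by
    have he : (fun y ↦ B y (T y v w) c) =ᶠ[𝓝 z] fun y ↦ fderiv ℝ B y v w c := by
      filter_upwards [hinv] with y hy using fderiv_fderiv_hessianCubic hy v w c
    have hTvw := (hTd.hasFDerivAt.clm_apply_const v).clm_apply_const w
    have h1 := ((hBd.hasFDerivAt.clm_apply hTvw).clm_apply_const c).fderiv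
    have h2 := (((hDd.hasFDerivAt.clm_apply_const v).clm_apply_const w).clm_apply_const c).fderiv
    have h3 := congrArg (fun f : E →L[ℝ] ℝ ↦ f u) (h1.symm.trans (he.fderiv_eq.trans h2))
    simp at h3
    have h4 : B z (T z u (T z v w)) c = fderiv ℝ B z u (T z v w) c :=
      fderiv_fderiv_hessianCubic hz _ _ _
    rw [h4]
    linarith
  have hsymm (c : E) : fderiv ℝ (fderiv ℝ B) z u v w c = fderiv ℝ (fderiv ℝ B) z v u w c := by
    rw [(hφ.fderiv_infty.fderiv_infty.isSymmSndFDerivAt (by simp; norm_cast)).eq u v]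
  obtain ⟨L, hL⟩ := hz
  apply L.injective
  ext c
  change (L : E →L[ℝ] E →L[ℝ] ℝ) _ c = (L : E →L[ℝ] E →L[ℝ] ℝ) _ c
  rw [hL]
  simp only [map_sub, _root_.sub_apply]
  rw [key, key, hsymm]
  ring

/-- The curvature of the connection `D + ½ T` on a vector space: the terms `½ DT` contribute
`-½ [T u, T v]` and the quadratic terms `¼ [T u, T v]`. -/
theorem hessianCov_curvature [FiniteDimensional ℝ E] (hφ : ContDiffAt ℝ ∞ φ z)
    (hz : (fderiv ℝ (fderiv ℝ φ) z).IsInvertible) {u v w : E → E} (hu : ContDiffAt ℝ ∞ u z)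
    (hv : ContDiffAt ℝ ∞ v z) (hw : ContDiffAt ℝ ∞ w z) :
    hessianCov φ (fun y ↦ hessianCov φ w y (v y)) z (u z)
        - hessianCov φ (fun y ↦ hessianCov φ w y (u y)) z (v z)
        - hessianCov φ w z (VectorField.lieBracket ℝ u v z)
      = (-1 / 4 : ℝ) • (hessianCubic φ z (u z) (hessianCubic φ z (v z) (w z))
          - hessianCubic φ z (v z) (hessianCubic φ z (u z) (w z))) := by
  have := FiniteDimensional.complete ℝ E
  have hT : DifferentiableAt ℝ (hessianCubic φ) z :=
    (hφ.hessianCubic hz).differentiableAt (by simp)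
  have hu' := hu.differentiableAt (by simp)
  have hv' := hv.differentiableAt (by simp)
  have hw' := hw.differentiableAt (by simp)
  have hDw := hw.fderiv_infty.differentiableAt (by simp)
  have hD (s : E → E) (hs : DifferentiableAt ℝ s z) (a : E) :
      fderiv ℝ (fun y ↦ hessianCov φ w y (s y)) z a
        = fderiv ℝ (fderiv ℝ w) z a (s z) + fderiv ℝ w z (fderiv ℝ s z a)
          + (1 / 2 : ℝ) • (fderiv ℝ (hessianCubic φ) z a (s z) (w z)
            + hessianCubic φ z (fderiv ℝ s z a) (w z)
            + hessianCubic φ z (s z) (fderiv ℝ w z a)) := by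
    have h := ((hDw.hasFDerivAt.clm_apply hs.hasFDerivAt).add
      (((hT.hasFDerivAt.clm_apply hs.hasFDerivAt).clm_apply hw'.hasFDerivAt).const_smul
        (1 / 2 : ℝ))).fderiv
    have h' := congrArg (fun f : E →L[ℝ] E ↦ f a) h
    refine h'.trans ?_
    simp
    module
  have hsub := fderiv_hessianCubic_sub hφ hz (u z) (v z) (w z)
  have hw2 : fderiv ℝ (fderiv ℝ w) z (u z) (v z) = fderiv ℝ (fderiv ℝ w) z (v z) (u z) :=
    (hw.isSymmSndFDerivAt (by simp; norm_cast)).eq _ _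
  rw [sub_eq_iff_eq_add] at hsub
  simp only [hessianCov, VectorField.lieBracket] at *
  rw [hD v hv', hD u hu', hsub, hw2]
  simp only [map_add, map_sub, map_smul, _root_.sub_apply]
  module

end Flat

/-! ### Vector fields in coordinates -/

section Coordinates

set_option maxSynthPendingDepth 3

open Topology VectorField

variable {E : Type*} [NormedAddCommGroup E] [NormedSpace ℝ E]
  {M : Type*} [TopologicalSpace M] [ChartedSpace E M] {e : OpenPartialHomeomorph M E}

/-- The derivative of the inverse of the coordinates `e` at `z`: the coordinate frame of the tangent
space at the point with coordinates `z`. -/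
noncomputable def coordFrame (e : OpenPartialHomeomorph M E) (z : E) :
    E →L[ℝ] TangentSpace 𝓘(ℝ, E) (e.symm z) :=
  mfderiv 𝓘(ℝ, E) 𝓘(ℝ, E) e.symm z

/-- The representation of the vector field `W` in the coordinates `e`. -/
noncomputable def coordRep (e : OpenPartialHomeomorph M E)
    (W : (y : M) → TangentSpace 𝓘(ℝ, E) y) (z : E) : E :=
  (coordFrame e z).inverse (W (e.symm z))

/-- The vector field on the domain of `e` that is represented by `V` in the coordinates `e`. -/
noncomputable def coordField (e : OpenPartialHomeomorph M E) (V : E → E) (y : M) :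
    TangentSpace 𝓘(ℝ, E) y :=
  (mfderiv 𝓘(ℝ, E) 𝓘(ℝ, E) e y).inverse (V (e y))

theorem OpenPartialHomeomorph.mdifferentiable_of_mem_maximalAtlas
    (he : e ∈ IsManifold.maximalAtlas 𝓘(ℝ, E) ∞ M) : e.MDifferentiable 𝓘(ℝ, E) 𝓘(ℝ, E) :=
  ⟨(contMDiffOn_of_mem_maximalAtlas he).mdifferentiableOn (by simp),
    (contMDiffOn_symm_of_mem_maximalAtlas he).mdifferentiableOn (by simp)⟩

theorem mdifferentiableAt_vectorSpace_iff_differentiableAt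
    {V : (z : E) → TangentSpace 𝓘(ℝ, E) z} {z : E} :
    MDiffAt (T% V) z ↔ DifferentiableAt ℝ (fun z ↦ (V z : E)) z := by
  rw [mdifferentiableAt_section]
  refine (Iff.of_eq ?_).trans mdifferentiableAt_iff_differentiableAt
  congr 1
  ext b
  rw [trivializationAt_model_space_apply]

namespace OpenPartialHomeomorph.MDifferentiable

variable (he : e.MDifferentiable 𝓘(ℝ, E) 𝓘(ℝ, E)) {z : E} (hz : z ∈ e.target)
include he hz

theorem isInvertible_coordFrame : (coordFrame e z).IsInvertible :=
  ⟨he.symm.mfderiv hz, rfl⟩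

theorem coordFrame_coordRep (W : (y : M) → TangentSpace 𝓘(ℝ, E) y) :
    coordFrame e z (coordRep e W z) = W (e.symm z) := by
  obtain ⟨L, hL⟩ := he.isInvertible_coordFrame hz
  rw [coordRep, ← hL, ContinuousLinearMap.inverse_equiv]
  exact L.apply_symm_apply _

theorem mfderiv_coordFrame (a : E) :
    mfderiv 𝓘(ℝ, E) 𝓘(ℝ, E) e (e.symm z) (coordFrame e z a) = a :=
  congrArg (fun A : E →L[ℝ] E ↦ A a) (he.comp_symm_deriv hz)

theorem coordField_symm (V : E → E) : coordField e V (e.symm z) = coordFrame e z (V z) := by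
  have hinv : (mfderiv 𝓘(ℝ, E) 𝓘(ℝ, E) e (e.symm z)).IsInvertible :=
    ⟨he.mfderiv (e.map_target hz), rfl⟩
  have hV : V (e (e.symm z)) = mfderiv 𝓘(ℝ, E) 𝓘(ℝ, E) e (e.symm z) (coordFrame e z (V z)) := by
    rw [he.mfderiv_coordFrame hz, e.right_inv hz]
  rw [coordField, hV]
  exact hinv.inverse_apply_self _

theorem coordRep_coordField (V : E → E) : coordRep e (coordField e V) z = V z := by
  rw [coordRep, he.coordField_symm hz]
  exact (he.isInvertible_coordFrame hz).inverse_apply_self _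

end OpenPartialHomeomorph.MDifferentiable

omit [NormedSpace ℝ E] [ChartedSpace E M] in
/-- A property that holds near `z` in the coordinates `e` holds near the point `e.symm z`. -/
theorem OpenPartialHomeomorph.eventually_symm {z : E} (hz : z ∈ e.target) {p : M → Prop}
    (hp : ∀ᶠ z' in 𝓝 z, p (e.symm z')) : ∀ᶠ y in 𝓝 (e.symm z), p y := by
  have h := e.continuousAt (e.map_target hz)
  rw [ContinuousAt, e.right_inv hz] at h
  filter_upwards [h.eventually hp, e.open_source.mem_nhds (e.map_target hz)] with y hy hys
  rwa [e.left_inv hys] at hy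

variable [CompleteSpace E] [IsManifold 𝓘(ℝ, E) ∞ M]
  (he : e ∈ IsManifold.maximalAtlas 𝓘(ℝ, E) ∞ M) {z : E} (hz : z ∈ e.target)
include he hz

theorem contDiffAt_coordRep {W : (y : M) → TangentSpace 𝓘(ℝ, E) y}
    (hW : CMDiffAt ∞ (T% W) (e.symm z)) : ContDiffAt ℝ ∞ (coordRep e W) z := by
  have hinv := (OpenPartialHomeomorph.mdifferentiable_of_mem_maximalAtlas
    he).isInvertible_coordFrame hz
  exact contMDiffAt_vectorSpace_iff_contDiffAt.1
    (hW.mpullback_vectorField_preimage (contMDiffAt_symm_of_mem_maximalAtlas he hz) hinv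
      (by norm_cast))

theorem differentiableAt_coordRep {W : (y : M) → TangentSpace 𝓘(ℝ, E) y}
    (hW : MDiffAt (T% W) (e.symm z)) : DifferentiableAt ℝ (coordRep e W) z := by
  have hinv := (OpenPartialHomeomorph.mdifferentiable_of_mem_maximalAtlas
    he).isInvertible_coordFrame hz
  exact mdifferentiableAt_vectorSpace_iff_differentiableAt.1
    (hW.mpullback_vectorField (contMDiffAt_symm_of_mem_maximalAtlas he hz) hinv (by norm_cast))

theorem mdifferentiableAt_coordField {V : E → E} (hV : DifferentiableAt ℝ V z) :
    MDiffAt (T% (coordField e V)) (e.symm z) := by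
  have hinv : (mfderiv 𝓘(ℝ, E) 𝓘(ℝ, E) e (e.symm z)).IsInvertible :=
    ⟨(OpenPartialHomeomorph.mdifferentiable_of_mem_maximalAtlas
      he).mfderiv (e.map_target hz), rfl⟩
  rw [← e.right_inv hz] at hV
  let V' : (z : E) → TangentSpace 𝓘(ℝ, E) z := V
  have hV' : MDiffAt (T% V') (e (e.symm z)) :=
    mdifferentiableAt_vectorSpace_iff_differentiableAt.2 hV
  exact hV'.mpullback_vectorField
    (contMDiffAt_of_mem_maximalAtlas he (e.map_target hz)) hinv (by norm_cast)

theorem mdifferentiableAt_of_coordRep {W : (y : M) → TangentSpace 𝓘(ℝ, E) y} {V : E → E}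
    (hV : DifferentiableAt ℝ V z) (h : coordRep e W =ᶠ[𝓝 z] V) :
    MDiffAt (T% W) (e.symm z) := by
  have hd := OpenPartialHomeomorph.mdifferentiable_of_mem_maximalAtlas he
  refine (mdifferentiableAt_coordField he hz hV).congr_of_eventuallyEq ?_
  refine e.eventually_symm hz ?_
  filter_upwards [h, e.open_target.mem_nhds hz] with z' h' hz'
  rw [hd.coordField_symm hz', ← h', hd.coordFrame_coordRep hz']

theorem coordRep_mlieBracket {U V : (y : M) → TangentSpace 𝓘(ℝ, E) y}
    (hU : MDiffAt (T% U) (e.symm z)) (hV : MDiffAt (T% V) (e.symm z)) :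
    coordRep e (mlieBracket 𝓘(ℝ, E) U V) z = lieBracket ℝ (coordRep e U) (coordRep e V) z := by
  have : IsManifold 𝓘(ℝ, E) (minSmoothness ℝ 2) M := by
    rw [minSmoothness_of_isRCLikeNormedField]; infer_instance
  have h := mpullback_mlieBracket (n := ∞) hU hV (contMDiffAt_symm_of_mem_maximalAtlas he hz)
    (by rw [minSmoothness_of_isRCLikeNormedField]; norm_cast)
  refine h.trans ?_
  rw [← mlieBracketWithin_univ, mlieBracketWithin_eq_lieBracketWithin]
  exact congrFun lieBracketWithin_univ z

theorem mlieBracket_coordField_const (a b : E) :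
    mlieBracket 𝓘(ℝ, E) (coordField e fun _ ↦ a) (coordField e fun _ ↦ b) (e.symm z) = 0 := by
  have hd := OpenPartialHomeomorph.mdifferentiable_of_mem_maximalAtlas he
  have hc (a : E) : coordRep e (coordField e fun _ ↦ a) =ᶠ[𝓝 z] fun _ ↦ a := by
    filter_upwards [e.open_target.mem_nhds hz] with z' hz' using hd.coordRep_coordField hz' _
  rw [← hd.coordFrame_coordRep hz (mlieBracket _ _ _), coordRep_mlieBracket he hz
    (mdifferentiableAt_coordField he hz (differentiableAt_const a))
    (mdifferentiableAt_coordField he hz (differentiableAt_const b)), lieBracket,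
    (hc a).fderiv_eq, (hc b).fderiv_eq]
  simp

end Coordinates

/-! ### The Levi-Civita connection in Hessian coordinates -/

section LeviCivita

open Topology VectorField

variable {E : Type*} [NormedAddCommGroup E] [NormedSpace ℝ E]
  {M : Type*} [TopologicalSpace M] [ChartedSpace E M]
  {e : OpenPartialHomeomorph M E} {φ : E → ℝ} {z : E}

/-- The differential of a function on `M`, computed in the coordinates `e`. -/
theorem fderiv_comp_symm (he : e.MDifferentiable 𝓘(ℝ, E) 𝓘(ℝ, E)) (hz : z ∈ e.target)
    {f : M → ℝ} (hf : MDiffAt f (e.symm z)) (a : E) :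
    fderiv ℝ (f ∘ e.symm) z a = d% f (e.symm z) (coordFrame e z a) := by
  rw [← mfderiv_eq_fderiv, mfderiv_comp z hf (he.mdifferentiableAt_symm hz)]
  rfl

theorem hessianCov_smul {f : E → ℝ} {w : E → E} (hf : DifferentiableAt ℝ f z)
    (hw : DifferentiableAt ℝ w z) (a : E) :
    hessianCov φ (f • w) z a = f z • hessianCov φ w z a + fderiv ℝ f z a • w z := by
  have h : fderiv ℝ (f • w) z = _ := fderiv_smul hf hw
  rw [hessianCov, hessianCov, h]
  simp only [Pi.smul_apply', map_smul, _root_.add_apply, _root_.smul_apply,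
    ContinuousLinearMap.smulRight_apply]
  module

theorem hessianCov_add {w w' : E → E} (hw : DifferentiableAt ℝ w z)
    (hw' : DifferentiableAt ℝ w' z) (a : E) :
    hessianCov φ (w + w') z a = hessianCov φ w z a + hessianCov φ w' z a := by
  rw [hessianCov, hessianCov, hessianCov, fderiv_add hw hw']
  simp only [Pi.add_apply, map_add, _root_.add_apply]
  module

theorem hessianCov_const (a b : E) :
    hessianCov φ (fun _ ↦ b) z a = (1 / 2 : ℝ) • hessianCubic φ z a b := by
  simp [hessianCov]

theorem Filter.EventuallyEq.hessianCov_eq {w w' : E → E} (h : w =ᶠ[𝓝 z] w') (a : E) :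
    hessianCov φ w z a = hessianCov φ w' z a := by
  rw [hessianCov, hessianCov, h.fderiv_eq, h.self_of_nhds]

variable [FiniteDimensional ℝ E] [RiemannianBundle (fun y : M ↦ TangentSpace 𝓘(ℝ, E) y)]

/-- The metric of `M` is the Hessian `D²φ` in the coordinates `e`. -/
def IsHessianChart (e : OpenPartialHomeomorph M E) (φ : E → ℝ) : Prop :=
  ∀ z ∈ e.target, ∀ a b : E, inner ℝ (coordFrame e z a) (coordFrame e z b)
    = fderiv ℝ (fderiv ℝ φ) z a b

/-- A Hessian metric has non-degenerate `D²φ`, so that `hessianCubic φ` is not a junk value. -/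
theorem IsHessianChart.isInvertible_fderiv_fderiv (h : IsHessianChart e φ)
    (he : e.MDifferentiable 𝓘(ℝ, E) 𝓘(ℝ, E)) (hz : z ∈ e.target) :
    (fderiv ℝ (fderiv ℝ φ) z).IsInvertible := by
  have hinj : Function.Injective (fderiv ℝ (fderiv ℝ φ) z) := by
    rw [injective_iff_map_eq_zero]
    intro a ha
    have h1 := h z hz a a
    rw [ha, _root_.zero_apply, inner_self_eq_zero] at h1
    obtain ⟨L, hL⟩ := he.isInvertible_coordFrame hz
    rw [← hL] at h1
    exact L.map_eq_zero_iff.1 h1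
  have hrank : Module.finrank ℝ E = Module.finrank ℝ (E →L[ℝ] ℝ) := by
    rw [← (LinearMap.toContinuousLinearMap (𝕜 := ℝ) (E := E) (F' := ℝ)).finrank_eq]
    exact Subspace.dual_finrank_eq.symm
  exact ⟨(LinearEquiv.ofInjectiveOfFinrankEq (fderiv ℝ (fderiv ℝ φ) z).toLinearMap
    hinj hrank).toContinuousLinearEquiv, rfl⟩

variable [IsManifold 𝓘(ℝ, E) ∞ M]
  [IsContMDiffRiemannianBundle 𝓘(ℝ, E) 1 E (fun y : M ↦ TangentSpace 𝓘(ℝ, E) y)]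
  (he : e ∈ IsManifold.maximalAtlas 𝓘(ℝ, E) ∞ M) (hφ : ContDiffOn ℝ ∞ φ e.target)
  (hg : IsHessianChart e φ) (hz : z ∈ e.target)
  (cov : CovariantDerivative 𝓘(ℝ, E) E (fun y : M ↦ TangentSpace 𝓘(ℝ, E) y))
  (htor : cov.torsion = 0) 
  (hmet : CovariantDerivative.IsMetricCompatible (V := fun y : M ↦ TangentSpace 𝓘(ℝ, E) y) cov)
include he hφ hg hz htor hmet

/-- The Christoffel symbols of a Hessian metric, from the Koszul formula: all three derivatives of
the metric in it are third derivatives of the potential. -/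
theorem cov_coordField_const (a b : E) :
    cov (coordField e fun _ ↦ b) (e.symm z) (coordFrame e z a)
      = coordFrame e z ((1 / 2 : ℝ) • hessianCubic φ z a b) := by
  have := FiniteDimensional.complete ℝ E
  have hd := OpenPartialHomeomorph.mdifferentiable_of_mem_maximalAtlas he
  have hφz : ContDiffAt ℝ ∞ φ z := hφ.contDiffAt (e.open_target.mem_nhds hz)
  have hinv := hg.isInvertible_fderiv_fderiv hd hz
  have hF (c : E) : MDiffAt (T% (coordField e fun _ ↦ c)) (e.symm z) :=
    mdifferentiableAt_coordField he hz (differentiableAt_const c)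
  set G : E → E → E → ℝ := fun a b c ↦
    inner ℝ (cov (coordField e fun _ ↦ b) (e.symm z) (coordFrame e z a)) (coordFrame e z c) with hG
  have hsymm (a b c : E) : G a b c = G b a c := by
    have h := cov.torsion_eq_zero_iff.1 htor (hF a) (hF b)
    rw [mlieBracket_coordField_const he hz, hd.coordField_symm hz, hd.coordField_symm hz,
      sub_eq_zero] at h
    simp only [hG, h]
  have hmetric (a b c : E) : G a b c + G a c b = fderiv ℝ (fderiv ℝ (fderiv ℝ φ)) z a b c := by
    have h := hmet.mvfderiv_inner_eq (coordField e fun _ ↦ a) (hF b) (hF c)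
    have hmd : MDiffAt (fun y : M ↦ (inner ℝ (coordField e (fun _ ↦ b) y)
        (coordField e (fun _ ↦ c) y) : ℝ)) (e.symm z) :=
      MDifferentiableAt.inner_bundle (F := E) (E := fun y : M ↦ TangentSpace 𝓘(ℝ, E) y) (hF b)
        (hF c)
    simp only [hd.coordField_symm hz] at h
    rw [← fderiv_comp_symm hd hz hmd] at h
    have he' : ((fun y : M ↦ (inner ℝ (coordField e (fun _ ↦ b) y)
        (coordField e (fun _ ↦ c) y) : ℝ)) ∘ e.symm)
        =ᶠ[𝓝 z] fun z' ↦ fderiv ℝ (fderiv ℝ φ) z' b c := by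
      filter_upwards [e.open_target.mem_nhds hz] with z' hz'
      rw [Function.comp_apply, hd.coordField_symm hz', hd.coordField_symm hz', hg z' hz']
    have hB : DifferentiableAt ℝ (fderiv ℝ (fderiv ℝ φ)) z :=
      hφz.fderiv_infty.fderiv_infty.differentiableAt (by simp)
    rw [he'.fderiv_eq, ((hB.hasFDerivAt.clm_apply_const b).clm_apply_const c).fderiv] at h
    refine Eq.trans ?_ h.symm
    simp only [hG]
    congr 1
    exact real_inner_comm _ _
  have key (c : E) : G a b c = (1 / 2 : ℝ) * fderiv ℝ (fderiv ℝ (fderiv ℝ φ)) z a b c := by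
    have h1 := hmetric a b c
    have h2 := hmetric b c a
    have h3 := hmetric c a b
    rw [hsymm b c a, hsymm b a c] at h2
    rw [hsymm c a b] at h3
    -- `G` is symmetric in its first two arguments, and all the sums `G a b c + G a c b` agree by
    -- the symmetry of `D³φ`
    have s1 := fderiv₃_comm_left hφz a b c
    have s2 := fderiv₃_comm_right hφz b a c
    have s3 := fderiv₃_comm_left hφz c a b
    have s4 := fderiv₃_comm_right hφz a c b
    linarith
  obtain ⟨L, hL⟩ := hd.isInvertible_coordFrame hz
  refine ext_inner_right ℝ fun v ↦ ?_
  obtain ⟨c, rfl⟩ : ∃ c, coordFrame e z c = v :=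
    ⟨L.symm v, by rw [← hL]; exact L.apply_symm_apply v⟩
  rw [hg z hz, map_smul, _root_.smul_apply, fderiv_fderiv_hessianCubic hinv, smul_eq_mul]
  exact key c

/-- In Hessian coordinates the Levi-Civita connection is `hessianCov`. -/
theorem cov_eq_hessianCov {W : (y : M) → TangentSpace 𝓘(ℝ, E) y} (hW : MDiffAt (T% W) (e.symm z))
    (a : E) :
    cov W (e.symm z) (coordFrame e z a) = coordFrame e z (hessianCov φ (coordRep e W) z a) := by
  have := FiniteDimensional.complete ℝ E
  have hd := OpenPartialHomeomorph.mdifferentiable_of_mem_maximalAtlas he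
  -- the difference of the two sides is a tensor in `W`, so `W` may be replaced by a vector field
  -- with constant coefficients
  have htens : TensorialAt 𝓘(ℝ, E) E (fun W ↦ cov W (e.symm z) (coordFrame e z a)
      - coordFrame e z (hessianCov φ (coordRep e W) z a)) (e.symm z) := by
    constructor
    · intro f W hf hW
      have hf' : DifferentiableAt ℝ (f ∘ e.symm) z :=
        (hf.comp z (hd.mdifferentiableAt_symm hz)).differentiableAt
      have hrep : coordRep e (f • W) = (f ∘ e.symm) • coordRep e W := by
        ext z'
        simp [coordRep]
      rw [cov.isCovariantDerivativeOnUniv.leibniz hW hf, hrep,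
        hessianCov_smul hf' (differentiableAt_coordRep he hz hW), fderiv_comp_symm hd hz hf,
        map_add, map_smul, map_smul, hd.coordFrame_coordRep hz]
      simp only [_root_.add_apply, _root_.smul_apply, ContinuousLinearMap.smulRight_apply,
        Function.comp_apply]
      module
    · intro W W' hW hW'
      have hrep : coordRep e (W + W') = coordRep e W + coordRep e W' := by
        ext z'
        simp [coordRep]
      rw [cov.isCovariantDerivativeOnUniv.add hW hW', hrep,
        hessianCov_add (differentiableAt_coordRep he hz hW) (differentiableAt_coordRep he hz hW'),
        map_add]
      simp only [_root_.add_apply]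
      abel
  have h := htens.pointwise hW
    (mdifferentiableAt_coordField he hz (differentiableAt_const (coordRep e W z)))
    (by rw [hd.coordField_symm hz, hd.coordFrame_coordRep hz])
  have hc : coordRep e (coordField e fun _ ↦ coordRep e W z) =ᶠ[𝓝 z] fun _ ↦ coordRep e W z := by
    filter_upwards [e.open_target.mem_nhds hz] with z' hz' using hd.coordRep_coordField hz' _
  rw [cov_coordField_const he hφ hg hz cov htor hmet, hc.hessianCov_eq, hessianCov_const,
    sub_self] at h
  exact sub_eq_zero.1 h

/-- The curvature of a Hessian metric is `R(u, v) = -¼ [T u, T v]`. -/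
theorem curvature_eq_commutator {U V W : (y : M) → TangentSpace 𝓘(ℝ, E) y}
    (hU : CMDiffAt ∞ (T% U) (e.symm z)) (hV : CMDiffAt ∞ (T% V) (e.symm z))
    (hW : CMDiffAt ∞ (T% W) (e.symm z)) :
    cov (fun y ↦ cov W y (V y)) (e.symm z) (U (e.symm z))
        - cov (fun y ↦ cov W y (U y)) (e.symm z) (V (e.symm z))
        - cov W (e.symm z) (mlieBracket 𝓘(ℝ, E) U V (e.symm z))
      = coordFrame e z ((-1 / 4 : ℝ) •
        (hessianCubic φ z (coordRep e U z) (hessianCubic φ z (coordRep e V z) (coordRep e W z))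
          - hessianCubic φ z (coordRep e V z)
              (hessianCubic φ z (coordRep e U z) (coordRep e W z)))) := by
  have := FiniteDimensional.complete ℝ E
  have hd := OpenPartialHomeomorph.mdifferentiable_of_mem_maximalAtlas he
  have hφz : ContDiffAt ℝ ∞ φ z := hφ.contDiffAt (e.open_target.mem_nhds hz)
  have hinv := hg.isInvertible_fderiv_fderiv hd hz
  have hu := contDiffAt_coordRep he hz hU
  have hv := contDiffAt_coordRep he hz hV
  have hw := contDiffAt_coordRep he hz hW
  have hWmd : ∀ᶠ z' in 𝓝 z, MDiffAt (T% W) (e.symm z') := by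
    have h1 : ∀ᶠ y in 𝓝 (e.symm z), CMDiffAt 1 (T% W) y :=
      (contMDiffAt_iff_contMDiffAt_nhds (by simp)).1 (hW.of_le (by norm_cast))
    filter_upwards [(e.symm.continuousAt hz).eventually h1] with z' h
    exact h.mdifferentiableAt one_ne_zero
  have hrep (X : (y : M) → TangentSpace 𝓘(ℝ, E) y) : coordRep e (fun y ↦ cov W y (X y))
      =ᶠ[𝓝 z] fun z' ↦ hessianCov φ (coordRep e W) z' (coordRep e X z') := by
    filter_upwards [hWmd, e.open_target.mem_nhds hz] with z' hW' hz'
    rw [coordRep, ← hd.coordFrame_coordRep hz' X,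
      cov_eq_hessianCov he hφ hg hz' cov htor hmet hW']
    exact (hd.isInvertible_coordFrame hz').inverse_apply_self _
  have hdiff {X : (y : M) → TangentSpace 𝓘(ℝ, E) y} (hX : ContDiffAt ℝ ∞ (coordRep e X) z) :
      MDiffAt (T% (fun y ↦ cov W y (X y))) (e.symm z) := by
    refine mdifferentiableAt_of_coordRep he hz (DifferentiableAt.add ?_ ?_) (hrep X)
    · exact (hw.fderiv_infty.differentiableAt (by simp)).clm_apply (hX.differentiableAt (by simp))
    · exact ((((hφz.hessianCubic hinv).differentiableAt (by simp)).clm_apply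
        (hX.differentiableAt (by simp))).clm_apply (hw.differentiableAt (by simp))).const_smul _
  have hU1 := hU.mdifferentiableAt (by simp)
  have hV1 := hV.mdifferentiableAt (by simp)
  have hW1 := hW.mdifferentiableAt (by simp)
  rw [← hd.coordFrame_coordRep hz U, ← hd.coordFrame_coordRep hz V,
    ← hd.coordFrame_coordRep hz (mlieBracket 𝓘(ℝ, E) U V), coordRep_mlieBracket he hz hU1 hV1,
    cov_eq_hessianCov he hφ hg hz cov htor hmet (hdiff hv),
    cov_eq_hessianCov he hφ hg hz cov htor hmet (hdiff hu),
    cov_eq_hessianCov he hφ hg hz cov htor hmet hW1,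
    (hrep V).hessianCov_eq, (hrep U).hessianCov_eq, ← map_sub, ← map_sub,
    hessianCov_curvature hφz hinv hu hv hw]

end LeviCivita

/-! ### Vanishing of the characteristic forms -/

/-- At each point the curvature of a Hessian metric is `-¼` times a commutator; `S` is the tensor
`hessianCubic` transported to the tangent space by the coordinate frame. -/
theorem IsHessianMetric.exists_curvatureTensor_eq {n : ℕ} {M : Type*} [TopologicalSpace M]
    [ChartedSpace (EuclideanSpace ℝ (Fin n)) M] [IsManifold (𝓡 n) ∞ M]
    [RiemannianBundle (fun x : M ↦ TangentSpace (𝓡 n) x)]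
    [IsContMDiffRiemannianBundle (𝓡 n) ∞ (EuclideanSpace ℝ (Fin n))
      (fun x : M ↦ TangentSpace (𝓡 n) x)]
    (hM : IsHessianMetric n M)
    (cov : CovariantDerivative (𝓡 n) (EuclideanSpace ℝ (Fin n))
      (fun x : M ↦ TangentSpace (𝓡 n) x))
    (hcov : IsLeviCivita cov) (x : M) :
    ∃ S : TangentSpace (𝓡 n) x →ₗ[ℝ] Module.End ℝ (TangentSpace (𝓡 n) x),
      ∀ u v w, curvatureTensor cov x u v w = (-1 / 4 : ℝ) • (S u (S v w) - S v (S u w)) := by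
  obtain ⟨e, he, hx, φ, hφ, hg⟩ := hM x
  have hd := OpenPartialHomeomorph.mdifferentiable_of_mem_maximalAtlas he
  obtain ⟨z, hz, rfl⟩ : ∃ z ∈ e.target, x = e.symm z :=
    ⟨e x, e.map_source hx, (e.left_inv hx).symm⟩
  have hg' : IsHessianChart e φ := by
    intro z hz a b
    have h := hg (e.symm z) (e.map_target hz) (coordFrame e z a) (coordFrame e z b)
    rw [hd.mfderiv_coordFrame hz, hd.mfderiv_coordFrame hz, e.right_inv hz] at h
    rw [h, iteratedFDeriv_two_apply]
    rfl
  have : IsContMDiffRiemannianBundle (𝓡 n) 1 (EuclideanSpace ℝ (Fin n))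
      (fun x : M ↦ TangentSpace (𝓡 n) x) := .of_le (n := ∞) (by norm_cast)
  obtain ⟨L, hL⟩ := hd.isInvertible_coordFrame hz
  let T : EuclideanSpace ℝ (Fin n) →ₗ[ℝ] Module.End ℝ (EuclideanSpace ℝ (Fin n)) :=
    ContinuousLinearMap.coeLM ℝ ∘ₗ (hessianCubic φ z).toLinearMap
  refine ⟨L.toLinearEquiv.conj.toLinearMap ∘ₗ T ∘ₗ L.symm.toLinearEquiv.toLinearMap,
    fun u v w ↦ ?_⟩
  have hrep (u : TangentSpace (𝓡 n) (e.symm z)) :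
      coordRep e (FiberBundle.extend (EuclideanSpace ℝ (Fin n)) u) z = L.symm u := by
    rw [coordRep, FiberBundle.extend_apply_self, ← hL, ContinuousLinearMap.inverse_equiv]
    rfl
  have h := curvature_eq_commutator he hφ hg' hz cov hcov.1 hcov.2
    (FiberBundle.contMDiffAt_extend _ _ u) (FiberBundle.contMDiffAt_extend _ _ v)
    (FiberBundle.contMDiffAt_extend _ _ w)
  simp only [hrep, ← hL] at h
  refine h.trans ?_
  simp [T, LinearEquiv.conj_apply]

theorem mainTheorem4 {n : ℕ} {M : Type*} [TopologicalSpace M]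
    [ChartedSpace (EuclideanSpace ℝ (Fin n)) M] [IsManifold (𝓡 n) ∞ M]
    [RiemannianBundle (fun x : M ↦ TangentSpace (𝓡 n) x)]
    [IsContMDiffRiemannianBundle (𝓡 n) ∞ (EuclideanSpace ℝ (Fin n))
      (fun x : M ↦ TangentSpace (𝓡 n) x)]
    (hM : IsHessianMetric n M)
    (cov : CovariantDerivative (𝓡 n) (EuclideanSpace ℝ (Fin n))
      (fun x : M ↦ TangentSpace (𝓡 n) x))
    (hcov : IsLeviCivita cov)
    (x : M) (b : Module.Basis (Fin n) ℝ (TangentSpace (𝓡 n) x)) :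
    (∀ k : ℕ, 1 ≤ k → pontryaginForm cov k x b = 0) ∧
      (∀ P : MvPolynomial (Fin n × Fin n) ℂ, IsInvariantPolynomial P →
        MvPolynomial.constantCoeff P = 0 → chernWeilForm cov P x b = 0) := by
  obtain ⟨S, hS⟩ := hM.exists_curvatureTensor_eq cov hcov x
  have h (P : MvPolynomial (Fin n × Fin n) ℂ) (hP : IsInvariantPolynomial P)
      (hP₀ : MvPolynomial.constantCoeff P = 0) : chernWeilForm cov P x b = 0 :=
    chernWeilForm_eq_zero_of_curvatureTensor_eq cov x S _ hS b hP hP₀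
  exact ⟨fun k hk ↦ h _ (isInvariantPolynomial_chernPolynomial n (2 * k))
    (constantCoeff_chernPolynomial n (by lia)), h⟩
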